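/- Let $n\ge 1$, let $f:\mathbb R^n\to\mathbb R$ be differentiable with $L$-Lipschitz gradient in the Euclidean norm ($L>0$), and let $\mu\in\mathbb R^n$ be unknown. The $k$-th pull of arm $i\in\{1,\dots,n\}$ returns $\mu_i+Z_{i,k}$, where the $Z_{i,k}$ are independent standard normal variables. Let $\varepsilon>0$ and $0<\delta<1$. Consider the following algorithm. Put $B_0=17Ln^2\varepsilon^{-1}\log(12n/\delta)$. For $r=1,2,\dots$: 1. Put $B_r=2^rB_0$ and pull each arm $\lceil B_r/n\rceil$ times. Let $\tilde B_r=\sum_{\ell=1}^r\lceil B_\ell/n\rceil$, let $\hat\mu^{(r)}_i$ be the average of the $\tilde B_r$ samples of arm $i$ taken in rounds $1,\dots,r$, and let $C_r=\sqrt{2\log(12nr^2/\delta)/\tilde B_r}$. 2. Let $\hat g_i^{(r,L)}$ and $\hat g_i^{(r,U)}$ be the minimum and the maximum of $|\partial_i f(y)|$ over all $y$ with $\|y-\hat\mu^{(r)}\|_\infty\le C_r$. Let $\alpha^{(r)}$ be the probability vector proportional to $(\hat g_i^{(r,L)})_{i}$ (an arbitrary fixed probability vector if all $\hat g_i^{(r,L)}$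 vanish), and put $\tilde T_i^{(r)}=\lceil(\alpha_i^{(r)}+\frac1n)B_r\rceil$. 3. If $\sum_i(\hat g_i^{(r,U)})^2/\tilde T_i^{(r)}\le \varepsilon^2/(16\log(6/\delta))$, pull each arm $i$ another $\tilde T_i^{(r)}$ times, let $\tilde\mu_i$ be the average of these new samples, return $f(\tilde\mu)$ and stop. Then with probability at least $1-\delta$ the algorithm stops and returns a value with $|f(\tilde\mu)-f(\mu)|\le\varepsilon$. Moreover, there is a universal constant $K$ (independent of $n,f,L,\mu,\varepsilon,\delta$) such that, if $B_0\ge n$, then with probability at least $1-\delta$ the algorithm stops, returns a value with $|f(\tilde\mu)-f(\mu)|\le\varepsilon$, and makes in total at most $$K\left(\frac{\|\nabla f(\mu)\|_1^2\log(6/\delta)}{\varepsilon^2}+\frac{n^2L\log(12n/\delta)}{\varepsilon}\right)$$ arm pulls. If in addition $\delta\le\frac12$, the same holds with the bound $$K\left(\frac{\|\nabla f(\mu)\|_1^2\log(1/\delta)}{\varepsilon^2}+\frac{n^2L\log(n/\delta)}{\varepsilon}\right).$$ -/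

import Mathlib

open MeasureTheory ProbabilityTheory
open scoped NNReal

noncomputable section

namespace AdaptiveEval

/-- The input of the algorithm: the number `n` of arms, the known function `f`, the Lipschitz
constant `L` of its gradient, the target accuracy `ε`, the error probability `δ`, and the vector
`q` of sampling frequencies used in the degenerate case where every lower gradient bound is `0`
(so that "proportional to the lower bounds" does not determine the frequencies). -/
structure Input (n : ℕ) where
  f : EuclideanSpace ℝ (Fin n) → ℝ
  L : ℝ≥0
  ε : ℝ
  δ : ℝ
  q : Fin n → ℝ

variable {n : ℕ} (I : Input n)

/-- Initial budget `B₀ = 17 L n² ε⁻¹ log (12 n / δ)`. -/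
def B₀ : ℝ := 17 * I.L * (n : ℝ) ^ 2 / I.ε * Real.log (12 * n / I.δ)

/-- Round budget `B_r = 2 ^ r B₀`. -/
def B (r : ℕ) : ℝ := B₀ I * 2 ^ r

/-- Number of uniform pulls of each arm made in the rounds `1, …, r`. -/
def uniformPulls (r : ℕ) : ℕ := ∑ l ∈ Finset.Icc 1 r, ⌈B I l / n⌉₊

/-- Confidence width `C_r`. -/
def C (r : ℕ) : ℝ := Real.sqrt (2 * Real.log (12 * n * (r : ℝ) ^ 2 / I.δ) / uniformPulls I r)

/-- Closed sup-norm ball of radius `c` around `x`. -/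
def box (x : EuclideanSpace ℝ (Fin n)) (c : ℝ) : Set (EuclideanSpace ℝ (Fin n)) :=
  {y | ∀ i, |y i - x i| ≤ c}

/- Below, `X i k` is the outcome of the `k`-th pull of arm `i` (counted from `0`). It is all that
the algorithm can see of the unknown means. Pulls of an arm are never reused across phases: after
round `r` the next fresh pull of any arm has index `uniformPulls I r`. -/
variable (X : Fin n → ℕ → ℝ)

/-- Estimate of the mean vector from all uniform pulls of the rounds `1, …, r`. -/
def muHat (r : ℕ) : EuclideanSpace ℝ (Fin n) :=
  WithLp.toLp 2 fun i => (∑ k ∈ Finset.range (uniformPulls I r), X i k) / uniformPulls I r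

/-- Lower gradient bound: the minimum of `|∇ᵢ f|` on the confidence box. -/
def gL (r : ℕ) (i : Fin n) : ℝ :=
  sInf ((fun y => |gradient I.f y i|) '' box (muHat I X r) (C I r))

/-- Upper gradient bound: the maximum of `|∇ᵢ f|` on the confidence box. -/
def gU (r : ℕ) (i : Fin n) : ℝ :=
  sSup ((fun y => |gradient I.f y i|) '' box (muHat I X r) (C I r))

open Classical in
/-- Sampling frequencies, proportional to the lower gradient bounds. -/
def alpha (r : ℕ) (i : Fin n) : ℝ :=
  if ∑ j, gL I X r j = 0 then I.q i else gL I X r i / ∑ j, gL I X r j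

/-- Number of pulls of arm `i` in the final phase, if the algorithm stops in round `r`. -/
def finalPulls (r : ℕ) (i : Fin n) : ℕ := ⌈(alpha I X r i + 1 / n) * B I r⌉₊

/-- The stopping condition checked in round `r`. -/
def StopCond (r : ℕ) : Prop :=
  ∑ i, gU I X r i ^ 2 / finalPulls I X r i ≤ I.ε ^ 2 / (16 * Real.log (6 / I.δ))

/-- The algorithm stops in round `r`: the first round (they are numbered from `1`) whose stopping
condition holds. -/
def StopsAt (r : ℕ) : Prop :=
  1 ≤ r ∧ StopCond I X r ∧ ∀ s, 1 ≤ s → s < r → ¬ StopCond I X s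

/-- The estimate built from the fresh pulls of the final phase, if the algorithm stops in round
`r`. The algorithm then returns `f (muTilde r)`. -/
def muTilde (r : ℕ) : EuclideanSpace ℝ (Fin n) :=
  WithLp.toLp 2 fun i =>
    (∑ k ∈ Finset.range (finalPulls I X r i), X i (uniformPulls I r + k)) / finalPulls I X r i

/-- Total number of arm pulls of a run that stops in round `r`, the uniform pulls of the rounds
`1, …, r` and those of the final phase. -/
def totalPulls (r : ℕ) : ℕ := ∑ i, (uniformPulls I r + finalPulls I X r i)

/-- `Returns I X y N`: on the outcomes `X` the algorithm terminates, returns the value `y`, and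
has made `N` arm pulls in total. -/
def Returns (y : ℝ) (N : ℕ) : Prop :=
  ∃ r, StopsAt I X r ∧ y = I.f (muTilde I X r) ∧ N = totalPulls I X r

end AdaptiveEval

end

/-!
The algorithm is analysed on the intersection of two events.

The confidence event `Confident` says that `μ` lies in the confidence box of every round. By a
Gaussian tail bound it fails with probability at most `δ / (6 n r ^ 2)` for each arm and each
round `r`, and these bounds sum to less than `δ / 2` (`Input.Valid.measure_not_confident_le`). On
this event the lower gradient bounds are below and the upper ones above `|∂ᵢ f μ|`. As the gradient
is Lipschitz, upper and lower bounds differ by at most `2 L √n C_r`, so sampling proportionally to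
the lower bounds makes the variance proxy `∑ gU ^ 2 / T` at most `2 ‖∇ f μ‖₁ ^ 2 / B_r` plus a term
that is always at most half of the stopping threshold (`Input.Valid.sum_sq_gU_div_le`,
`Input.Valid.box_term_le`). Hence the algorithm stops as soon as `B_r` exceeds
`64 ‖∇ f μ‖₁ ^ 2 log (6 / δ) / ε ^ 2`. Since budgets double, the budget of the last round exceeds
the maximum of this number and `B₀` by at most a factor of `2` (`Input.Valid.exists_stopsAt`), and
if `B₀ ≥ n` the number of pulls is at most six times that budget (`Input.Valid.totalPulls_le`).

The second event concerns the final phase. There the error of the output is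
`⟪∇ f μ, muTilde - μ⟫` up to `L ‖muTilde - μ‖ ^ 2`. On the confidence event the linear part has
variance at most the variance proxy, which the stopping condition bounds, and the quadratic part is
small because each arm is pulled at least `B_r / n` times
(`Input.Valid.abs_sub_le_of_not_finalBad`, `Input.Valid.measure_finalBad_le`). The number of pulls
in the final phase is random, but it is determined, like the stopping round, by pulls that are not
reused. Splitting into the countably many possible values of the stopping round and of the numbers
of final pulls, each piece is the intersection of an event of the past with an independent event of
the future, so the failure probability for fixed numbers of pulls, at most `δ / 2`, is not increased
(`measure_iUnion_inter_le`, `Input.Valid.measure_exceptional_le`).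
-/

namespace AdaptiveEval

/-! ### Concentration and independence -/

section Probability

variable {Ω : Type*} [MeasurableSpace Ω] {P : Measure Ω}

lemma hasSubgaussianMGF_of_map_eq_gaussianReal {Y : Ω → ℝ}
    (hY : P.map Y = gaussianReal 0 1) : HasSubgaussianMGF Y 1 P := by
  have hm : AEMeasurable Y P := by
    by_contra h
    rw [Measure.map_of_not_aemeasurable h] at hY
    exact (IsProbabilityMeasure.ne_zero (gaussianReal 0 1)) hY.symm
  refine HasSubgaussianMGF.of_map (X := id) hm ?_
  rw [hY]
  refine ⟨fun t => by simpa using integrable_exp_mul_gaussianReal t, fun t => ?_⟩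
  rw [mgf_id_gaussianReal]
  simp

/-- Two-sided Gaussian tail bound for a linear combination of independent standard normal
variables. Only an upper bound `v` on the variance is needed. -/
lemma measure_lt_abs_sum_le {ι : Type*} {Y : ι → Ω → ℝ} (hind : iIndepFun Y P)
    (hY : ∀ p, P.map (Y p) = gaussianReal 0 1) (s : Finset ι) (a : ι → ℝ) {v t x : ℝ}
    (hv : 0 < v) (hav : ∑ p ∈ s, a p ^ 2 ≤ v) (ht : 0 ≤ t) (hx : 2 * v * x ≤ t ^ 2) :
    P {ω | t < |∑ p ∈ s, a p * Y p ω|} ≤ ENNReal.ofReal (2 * Real.exp (-x)) := by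
  have := hind.isProbabilityMeasure
  have hsub : HasSubgaussianMGF (fun ω => ∑ p ∈ s, a p * Y p ω)
      (∑ p ∈ s, (a p ^ 2).toNNReal) P := by
    refine HasSubgaussianMGF.sum_of_iIndepFun (X := fun p ω => a p * Y p ω)
      (hind.comp (fun p y => a p * y) fun p => measurable_const_mul (a p)) fun p _ => ?_
    have h := (hasSubgaussianMGF_of_map_eq_gaussianReal (hY p)).const_mul (a p)
    convert h using 1
    exact (Real.toNNReal_of_nonneg (sq_nonneg _)).trans (mul_one (_ : ℝ≥0)).symm
  have hsub : HasSubgaussianMGF (fun ω => ∑ p ∈ s, a p * Y p ω) v.toNNReal P := by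
    refine ⟨hsub.integrable_exp_mul, fun b => (hsub.mgf_le b).trans ?_⟩
    refine Real.exp_le_exp.2 ?_
    have h : ((∑ p ∈ s, (a p ^ 2).toNNReal : ℝ≥0) : ℝ) ≤ v.toNNReal := by
      rw [Real.coe_toNNReal _ hv.le]
      push_cast
      simpa [Real.coe_toNNReal, sq_nonneg] using hav
    gcongr
  have hexp : Real.exp (-t ^ 2 / (2 * (v.toNNReal : ℝ))) ≤ Real.exp (-x) := by
    refine Real.exp_le_exp.2 ?_
    rw [Real.coe_toNNReal _ hv.le, div_le_iff₀ (by positivity)]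
    linarith
  have h1 := (hsub.measure_ge_le ht).trans hexp
  have h2 := (hsub.neg.measure_ge_le ht).trans hexp
  calc P {ω | t < |∑ p ∈ s, a p * Y p ω|}
      ≤ P ({ω | t ≤ ∑ p ∈ s, a p * Y p ω} ∪ {ω | t ≤ (-fun ω => ∑ p ∈ s, a p * Y p ω) ω}) := by
        refine measure_mono fun ω hω => ?_
        rcases lt_abs.1 (show t < |∑ p ∈ s, a p * Y p ω| from hω) with h | h
        · exact Or.inl h.le
        · exact Or.inr h.le
    _ ≤ ENNReal.ofReal (Real.exp (-x)) + ENNReal.ofReal (Real.exp (-x)) := by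
        refine (measure_union_le _ _).trans (add_le_add ?_ ?_)
        · rw [← ofReal_measureReal]; exact ENNReal.ofReal_le_ofReal h1
        · rw [← ofReal_measureReal]; exact ENNReal.ofReal_le_ofReal h2
    _ = ENNReal.ofReal (2 * Real.exp (-x)) := by
        rw [← ENNReal.ofReal_add (Real.exp_pos _).le (Real.exp_pos _).le, two_mul]

/-- An event that depends only on the variables with indices in `S` is measurable for every
σ-algebra that makes these variables measurable. -/
lemma measurableSet_of_dependsOn {Ω ι : Type*} {m : MeasurableSpace Ω} {Z : ι → ℕ → Ω → ℝ}
    {S : Set (ι × ℕ)} (hZ : ∀ i k, (i, k) ∈ S → Measurable (Z i k))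
    {E : Set (ι → ℕ → ℝ)} (hE : MeasurableSet E)
    (hE' : ∀ z z' : ι → ℕ → ℝ, (∀ i k, (i, k) ∈ S → z i k = z' i k) → (z ∈ E ↔ z' ∈ E)) :
    MeasurableSet {ω | (fun i k => Z i k ω) ∈ E} := by
  classical
  -- Setting the other variables to `0` does not change the event.
  have h : {ω | (fun i k => Z i k ω) ∈ E} =
      (fun ω i k => if (i, k) ∈ S then Z i k ω else 0) ⁻¹' E := by
    ext ω
    exact hE' _ _ fun i k hik => by simp [hik]
  rw [h]
  refine MeasurableSet.preimage hE ?_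
  refine measurable_pi_lambda _ fun i => measurable_pi_lambda _ fun k => ?_
  by_cases hik : (i, k) ∈ S
  · simpa only [hik, if_true] using hZ i k hik
  · simp only [hik, if_false]
    exact measurable_const

/-- An event that depends only on the pulls with index below `u` is independent of an event that
depends only on the pulls with index at least `u`. -/
lemma measure_inter_of_past_future {ι : Type*} {Z : ι → ℕ → Ω → ℝ}
    (hZ : ∀ i k, Measurable (Z i k)) (hind : iIndepFun (fun p : ι × ℕ => Z p.1 p.2) P)
    (u : ℕ) {A D : Set (ι → ℕ → ℝ)} (hA : MeasurableSet A) (hD : MeasurableSet D)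
    (hA' : ∀ z z' : ι → ℕ → ℝ, (∀ i, ∀ k < u, z i k = z' i k) → (z ∈ A ↔ z' ∈ A))
    (hD' : ∀ z z' : ι → ℕ → ℝ, (∀ i k, u ≤ k → z i k = z' i k) → (z ∈ D ↔ z' ∈ D)) :
    P ({ω | (fun i k => Z i k ω) ∈ A} ∩ {ω | (fun i k => Z i k ω) ∈ D}) =
      P {ω | (fun i k => Z i k ω) ∈ A} * P {ω | (fun i k => Z i k ω) ∈ D} := by
  have hle : ∀ (S : Set (ι × ℕ)) (i : ι) (k : ℕ), (i, k) ∈ S →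
      Measurable[⨆ p ∈ S, MeasurableSpace.comap (Z p.1 p.2) inferInstance] (Z i k) :=
    fun S i k hik => (comap_measurable (Z i k)).mono
      (le_iSup₂_of_le (f := fun (p : ι × ℕ) (_ : p ∈ S) =>
        MeasurableSpace.comap (Z p.1 p.2) inferInstance) (i, k) hik le_rfl) le_rfl
  have hI := indep_iSup_of_disjoint (μ := P)
    (m := fun p : ι × ℕ => MeasurableSpace.comap (Z p.1 p.2) inferInstance)
    (fun p => (hZ p.1 p.2).comap_le) ((iIndepFun_iff_iIndep _ _ _).1 hind)
    (S := {p | p.2 < u}) (T := {p | u ≤ p.2})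
    (Set.disjoint_left.2 fun p (hp : p.2 < u) (hp' : u ≤ p.2) => absurd hp (not_lt.2 hp'))
  exact (Indep_iff _ _ _).1 hI _ _
    (measurableSet_of_dependsOn (hle _) hA fun z z' h => hA' z z' fun i k hk => h i k hk)
    (measurableSet_of_dependsOn (hle _) hD fun z z' h => hD' z z' fun i k hk => h i k hk)

/-- If the event that occurs, among countably many disjoint events `E j`, selects a failure event
`D j` that is independent of it and has probability at most `p`, the selected failure has
probability at most `p`. -/
lemma measure_iUnion_inter_le [IsProbabilityMeasure P] {ι : Type*} [Countable ι]
    {E D : ι → Set Ω} {p : ENNReal}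
    (hE : ∀ j, MeasurableSet (E j)) (hdisj : Pairwise (Function.onFun Disjoint E))
    (hind : ∀ j, P (E j ∩ D j) = P (E j) * P (D j)) (hD : ∀ j, P (D j) ≤ p) :
    P (⋃ j, E j ∩ D j) ≤ p := by
  calc P (⋃ j, E j ∩ D j) ≤ ∑' j, P (E j ∩ D j) := measure_iUnion_le _
    _ ≤ ∑' j, P (E j) * p := ENNReal.tsum_le_tsum fun j => by
        rw [hind]; gcongr; exact hD j
    _ = P (⋃ j, E j) * p := by rw [ENNReal.tsum_mul_right, measure_iUnion hdisj hE]
    _ ≤ 1 * p := by gcongr; exact prob_le_one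
    _ = p := one_mul p

lemma ofReal_one_sub_le_measure [IsProbabilityMeasure P] {S T : Set Ω} {δ : ℝ} (hδ : 0 ≤ δ)
    (hST : Sᶜ ⊆ T) (hT : P T ≤ ENNReal.ofReal δ) : ENNReal.ofReal (1 - δ) ≤ P S := by
  rw [ENNReal.ofReal_sub _ hδ, ENNReal.ofReal_one]
  refine tsub_le_iff_right.2 ?_
  calc (1 : ENNReal) = P (S ∪ Sᶜ) := by simp
    _ ≤ P S + P Sᶜ := measure_union_le _ _
    _ ≤ P S + ENNReal.ofReal δ := by gcongr; exact (measure_mono hST).trans hT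

end Probability

/-! ### Confidence boxes and gradient bounds -/

lemma box_eq_image {n : ℕ} (x : EuclideanSpace ℝ (Fin n)) (c : ℝ) :
    box x c = (fun z => x + z) '' box 0 c := by
  ext y
  constructor
  · intro hy
    exact ⟨y - x, fun i => by simpa using hy i, by simp⟩
  · rintro ⟨z, hz, rfl⟩ i
    simpa using hz i

lemma isCompact_box {n : ℕ} (x : EuclideanSpace ℝ (Fin n)) (c : ℝ) : IsCompact (box x c) := by
  have h : box x c = WithLp.toLp 2 '' Set.univ.pi fun i => Set.Icc (x i - c) (x i + c) := by
    ext y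
    constructor
    · intro hy
      refine ⟨y.ofLp, fun i _ => ?_, rfl⟩
      have := abs_le.1 (hy i)
      exact ⟨by linarith, by linarith⟩
    · rintro ⟨z, hz, rfl⟩ i
      have := hz i (Set.mem_univ i)
      exact abs_le.2 ⟨by linarith [this.1], by linarith [this.2]⟩
  rw [h]
  exact (isCompact_univ_pi fun _ => isCompact_Icc).image (PiLp.continuous_toLp 2 _)

/-- The square of the Euclidean diameter of a sup-norm ball of radius `c` is at most
`4 n c ^ 2`. -/
lemma norm_sub_sq_le_of_mem_box {n : ℕ} {x y y' : EuclideanSpace ℝ (Fin n)} {c : ℝ}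
    (hy : y ∈ box x c) (hy' : y' ∈ box x c) : ‖y - y'‖ ^ 2 ≤ 4 * n * c ^ 2 := by
  rw [EuclideanSpace.norm_sq_eq]
  calc ∑ i, ‖(y - y') i‖ ^ 2 ≤ ∑ _i : Fin n, 4 * c ^ 2 := by
        refine Finset.sum_le_sum fun i _ => ?_
        have h1 := abs_le.1 (hy i)
        have h2 := abs_le.1 (hy' i)
        rw [Real.norm_eq_abs, sq_abs, PiLp.sub_apply]
        nlinarith
    _ = 4 * n * c ^ 2 := by simp; ring

variable {n : ℕ} {I : Input n}

/-- The assumptions on the input of the algorithm. -/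
structure Input.Valid (I : Input n) : Prop where
  one_le : 1 ≤ n
  L_pos : 0 < I.L
  ε_pos : 0 < I.ε
  δ_pos : 0 < I.δ
  δ_lt_one : I.δ < 1
  differentiable : Differentiable ℝ I.f
  lipschitz : LipschitzWith I.L (gradient I.f)
  q_mem : I.q ∈ stdSimplex ℝ (Fin n)

lemma B_div_le_uniformPulls {r : ℕ} (hr : 1 ≤ r) :
    B I r / n ≤ uniformPulls I r := by
  refine (Nat.le_ceil _).trans ?_
  exact_mod_cast Finset.single_le_sum (f := fun l => ⌈B I l / n⌉₊) (fun _ _ => Nat.zero_le _)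
    (Finset.mem_Icc.2 ⟨hr, le_rfl⟩)

namespace Input.Valid

lemma n_pos (hI : I.Valid) : (0 : ℝ) < n := by exact_mod_cast hI.one_le

lemma one_le_cast (hI : I.Valid) : (1 : ℝ) ≤ n := by exact_mod_cast hI.one_le

lemma L_pos' (hI : I.Valid) : (0 : ℝ) < I.L := hI.L_pos

lemma twelve_le (hI : I.Valid) : 12 ≤ 12 * n / I.δ := by
  rw [le_div_iff₀ hI.δ_pos]
  nlinarith [hI.one_le_cast, hI.δ_lt_one]

lemma two_le_log (hI : I.Valid) : 2 ≤ Real.log (12 * n / I.δ) := by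
  have h := hI.twelve_le
  rw [Real.le_log_iff_exp_le (by linarith)]
  have h1 : Real.exp 2 = Real.exp 1 ^ 2 := by rw [← Real.exp_nat_mul]; norm_num
  have h2 := Real.exp_one_lt_d9
  have h3 := Real.exp_pos 1
  nlinarith

lemma log_pos (hI : I.Valid) : 0 < Real.log (12 * n / I.δ) := by linarith [hI.two_le_log]

lemma log_six_pos (hI : I.Valid) : 0 < Real.log (6 / I.δ) := by
  refine Real.log_pos ?_
  rw [lt_div_iff₀ hI.δ_pos]
  linarith [hI.δ_lt_one]

lemma log_six_le (hI : I.Valid) : Real.log (6 / I.δ) ≤ Real.log (12 * n / I.δ) := by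
  have := hI.δ_pos
  refine Real.log_le_log (by positivity) ?_
  gcongr
  linarith [hI.one_le_cast]

/-- The logarithm in the confidence width of round `r` exceeds `log (12 n / δ)` by a factor of at
most `r`. -/
lemma log_round_le (hI : I.Valid) {r : ℕ} (hr : 1 ≤ r) :
    Real.log (12 * n * (r : ℝ) ^ 2 / I.δ) ≤ r * Real.log (12 * n / I.δ) := by
  have hr0 : (0 : ℝ) < r := by exact_mod_cast hr
  have hr1 : (1 : ℝ) ≤ r := by exact_mod_cast hr
  have h : 12 * n * (r : ℝ) ^ 2 / I.δ = 12 * n / I.δ * (r : ℝ) ^ 2 := by ring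
  rw [h, Real.log_mul (by linarith [hI.twelve_le]) (by positivity), Real.log_pow]
  have h1 := Real.log_le_sub_one_of_pos hr0
  have h2 := hI.two_le_log
  push_cast
  nlinarith

lemma log_round_pos (hI : I.Valid) {r : ℕ} (hr : 1 ≤ r) :
    0 < Real.log (12 * n * (r : ℝ) ^ 2 / I.δ) := by
  refine Real.log_pos ?_
  have hr1 : (1 : ℝ) ≤ r := by exact_mod_cast hr
  have h : 12 * n * (r : ℝ) ^ 2 / I.δ = 12 * n / I.δ * (r : ℝ) ^ 2 := by ring
  rw [h]
  nlinarith [hI.twelve_le]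

lemma B₀_pos (hI : I.Valid) : 0 < B₀ I := by
  have := hI.log_pos
  have := hI.n_pos
  have := hI.L_pos'
  have := hI.ε_pos
  unfold B₀
  positivity

lemma B_pos (hI : I.Valid) (r : ℕ) : 0 < B I r := by
  have := hI.B₀_pos
  unfold B
  positivity

lemma two_mul_B₀_le_B (hI : I.Valid) {r : ℕ} (hr : 1 ≤ r) : 2 * B₀ I ≤ B I r := by
  have h : (2 : ℝ) ^ 1 ≤ 2 ^ r := pow_le_pow_right₀ one_le_two hr
  unfold B
  nlinarith [hI.B₀_pos]

lemma uniformPulls_pos (hI : I.Valid) {r : ℕ} (hr : 1 ≤ r) : (0 : ℝ) < uniformPulls I r :=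
  (div_pos (hI.B_pos r) hI.n_pos).trans_le (B_div_le_uniformPulls hr)

lemma sq_C (hI : I.Valid) {r : ℕ} (hr : 1 ≤ r) :
    C I r ^ 2 = 2 * Real.log (12 * n * (r : ℝ) ^ 2 / I.δ) / uniformPulls I r := by
  have := hI.log_round_pos hr
  have := hI.uniformPulls_pos hr
  exact Real.sq_sqrt (by positivity)

lemma sq_C_le (hI : I.Valid) {r : ℕ} (hr : 1 ≤ r) :
    C I r ^ 2 ≤ 2 * n * r * Real.log (12 * n / I.δ) / B I r := by
  have h1 := hI.log_round_le hr
  have h2 := hI.B_pos r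
  have h3 := hI.n_pos
  have h4 := hI.log_pos
  rw [hI.sq_C hr]
  calc 2 * Real.log (12 * n * (r : ℝ) ^ 2 / I.δ) / uniformPulls I r
      ≤ 2 * (r * Real.log (12 * n / I.δ)) / (B I r / n) := by
        gcongr
        exact B_div_le_uniformPulls hr
    _ = _ := by field_simp

end Input.Valid

variable {X : Fin n → ℕ → ℝ} {μ : EuclideanSpace ℝ (Fin n)}

lemma gL_nonneg (r : ℕ) (i : Fin n) : 0 ≤ gL I X r i :=
  Real.sInf_nonneg (by rintro _ ⟨y, -, rfl⟩; exact abs_nonneg _)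

lemma gU_nonneg (r : ℕ) (i : Fin n) : 0 ≤ gU I X r i :=
  Real.sSup_nonneg (by rintro _ ⟨y, -, rfl⟩; exact abs_nonneg _)

lemma gL_le {r : ℕ} (hμ : μ ∈ box (muHat I X r) (C I r)) (i : Fin n) :
    gL I X r i ≤ |gradient I.f μ i| :=
  csInf_le ⟨0, by rintro _ ⟨y, -, rfl⟩; exact abs_nonneg _⟩ ⟨μ, hμ, rfl⟩

lemma Input.Valid.continuous_abs_gradient (hI : I.Valid) (i : Fin n) :
    Continuous fun y => |gradient I.f y i| := by
  have := hI.lipschitz.continuous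
  fun_prop

lemma Input.Valid.le_gU (hI : I.Valid) {r : ℕ} (hμ : μ ∈ box (muHat I X r) (C I r))
    (i : Fin n) : |gradient I.f μ i| ≤ gU I X r i :=
  le_csSup ((isCompact_box _ _).image (hI.continuous_abs_gradient i)).bddAbove ⟨μ, hμ, rfl⟩

/-- Since the gradient is Lipschitz, its upper and lower bounds on the confidence box are close. -/
lemma Input.Valid.sq_gU_le (hI : I.Valid) (r : ℕ) (i : Fin n) :
    gU I X r i ^ 2 ≤ 2 * gL I X r i ^ 2 + 8 * n * I.L ^ 2 * C I r ^ 2 := by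
  set d : ℝ := Real.sqrt (4 * n * (C I r) ^ 2) with hd
  have hd2 : d ^ 2 = 4 * n * (C I r) ^ 2 := Real.sq_sqrt (by positivity)
  have hC : 0 ≤ C I r := Real.sqrt_nonneg _
  have hne : (box (muHat I X r) (C I r)).Nonempty := ⟨muHat I X r, fun i => by simpa using hC⟩
  have h : gU I X r i ≤ gL I X r i + I.L * d := by
    refine csSup_le (hne.image _) ?_
    rintro _ ⟨y, hy, rfl⟩
    rw [← sub_le_iff_le_add]
    refine le_csInf (hne.image _) ?_
    rintro _ ⟨y', hy', rfl⟩
    have h1 : |gradient I.f y i - gradient I.f y' i| ≤ ‖gradient I.f y - gradient I.f y'‖ := by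
      simpa using PiLp.norm_apply_le (gradient I.f y - gradient I.f y') i
    have h2 := hI.lipschitz.norm_sub_le y y'
    have h3 : ‖y - y'‖ ≤ d := Real.le_sqrt_of_sq_le (norm_sub_sq_le_of_mem_box hy hy')
    have h4 : I.L * ‖y - y'‖ ≤ I.L * d := by gcongr
    have h5 := abs_sub_abs_le_abs_sub (gradient I.f y i) (gradient I.f y' i)
    simp only
    linarith
  have h0 := gU_nonneg (I := I) (X := X) r i
  calc gU I X r i ^ 2 ≤ (gL I X r i + I.L * d) ^ 2 := by gcongr
    _ ≤ 2 * gL I X r i ^ 2 + 2 * (I.L ^ 2 * d ^ 2) := by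
        nlinarith [sq_nonneg (gL I X r i - I.L * d)]
    _ = _ := by rw [hd2]; ring

lemma Input.Valid.alpha_mem (hI : I.Valid) (r : ℕ) : alpha I X r ∈ stdSimplex ℝ (Fin n) := by
  by_cases h : ∑ j, gL I X r j = 0
  · have : alpha I X r = I.q := by ext i; simp [alpha, h]
    rw [this]; exact hI.q_mem
  · refine ⟨fun i => ?_, ?_⟩
    · simp only [alpha, h, if_false]
      exact div_nonneg (gL_nonneg r i) (Finset.sum_nonneg fun j _ => gL_nonneg r j)
    · simp only [alpha, h, if_false]
      rw [← Finset.sum_div, div_self h]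

/-! ### The final phase: number of pulls and variance proxy -/

lemma le_finalPulls (r : ℕ) (i : Fin n) :
    (alpha I X r i + 1 / n) * B I r ≤ finalPulls I X r i := Nat.le_ceil _

lemma Input.Valid.B_div_le_finalPulls (hI : I.Valid) (r : ℕ) (i : Fin n) :
    B I r / n ≤ finalPulls I X r i := by
  refine le_trans ?_ (le_finalPulls r i)
  have := mul_nonneg ((hI.alpha_mem (X := X) r).1 i) (hI.B_pos r).le
  rw [add_mul, one_div_mul_eq_div]
  linarith

lemma Input.Valid.finalPulls_pos (hI : I.Valid) (r : ℕ) (i : Fin n) :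
    (0 : ℝ) < finalPulls I X r i :=
  (div_pos (hI.B_pos r) hI.n_pos).trans_le (hI.B_div_le_finalPulls r i)

lemma Input.Valid.gL_mul_B_le (hI : I.Valid) (r : ℕ) (i : Fin n) :
    gL I X r i * B I r ≤ (∑ j, gL I X r j) * finalPulls I X r i := by
  have h0 : 0 ≤ ∑ j, gL I X r j := Finset.sum_nonneg fun j _ => gL_nonneg r j
  rcases h0.eq_or_lt with h | h
  · have : gL I X r i = 0 :=
      (Finset.sum_eq_zero_iff_of_nonneg fun j _ => gL_nonneg r j).1 h.symm i (Finset.mem_univ i)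
    rw [this, ← h]; simp
  · have h1 := le_finalPulls (I := I) (X := X) r i
    have h2 : gL I X r i = (∑ j, gL I X r j) * alpha I X r i := by
      simp only [alpha, h.ne', if_false]
      field_simp
    have h3 := hI.B_pos r
    have h4 : alpha I X r i * B I r ≤ finalPulls I X r i := by
      refine le_trans ?_ h1
      gcongr
      simp
    calc gL I X r i * B I r = (∑ j, gL I X r j) * (alpha I X r i * B I r) := by
          rw [← mul_assoc, ← h2]
      _ ≤ _ := by gcongr

/-- The variance proxy of the final phase is governed by the squared `ℓ¹`-norm of the lower
gradient bounds, up to an error due to the size of the confidence box. -/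
lemma Input.Valid.sum_sq_gU_div_le (hI : I.Valid) (r : ℕ) :
    ∑ i, gU I X r i ^ 2 / finalPulls I X r i ≤
      2 * (∑ i, gL I X r i) ^ 2 / B I r + 8 * n ^ 3 * I.L ^ 2 * C I r ^ 2 / B I r := by
  have hB := hI.B_pos r
  have hn := hI.n_pos
  have hi : ∀ i, gU I X r i ^ 2 / finalPulls I X r i ≤
      2 * (gL I X r i * ((∑ j, gL I X r j) / B I r)) +
        8 * n * I.L ^ 2 * C I r ^ 2 * (n / B I r) := by
    intro i
    have hT := hI.finalPulls_pos (X := X) r i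
    have h1 : gL I X r i / finalPulls I X r i ≤ (∑ j, gL I X r j) / B I r := by
      rw [div_le_div_iff₀ hT hB]
      exact hI.gL_mul_B_le r i
    have h2 : 1 / (finalPulls I X r i : ℝ) ≤ n / B I r := by
      rw [div_le_div_iff₀ hT hB]
      have := hI.B_div_le_finalPulls (X := X) r i
      rw [div_le_iff₀ hn] at this
      linarith
    have h0 := gL_nonneg (I := I) (X := X) r i
    calc gU I X r i ^ 2 / finalPulls I X r i
        ≤ (2 * gL I X r i ^ 2 + 8 * n * I.L ^ 2 * C I r ^ 2) / finalPulls I X r i := by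
          gcongr; exact hI.sq_gU_le r i
      _ = 2 * (gL I X r i * (gL I X r i / finalPulls I X r i)) +
          8 * n * I.L ^ 2 * C I r ^ 2 * (1 / finalPulls I X r i) := by ring
      _ ≤ _ := by gcongr
  refine (Finset.sum_le_sum fun i _ => hi i).trans (le_of_eq ?_)
  rw [Finset.sum_add_distrib, ← Finset.mul_sum, ← Finset.sum_mul]
  simp
  ring

/-- The contribution of the size of the confidence box to the variance proxy is at most half of
what the stopping condition allows. Indeed
`C_r ^ 2 / B_r` is of order at most `n r log (12 n / δ) / B_r ^ 2`, and `B_r` is of order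
`2 ^ r n ^ 2 L log (12 n / δ) / ε`. -/
lemma Input.Valid.box_term_le (hI : I.Valid) {r : ℕ} (hr : 1 ≤ r) :
    8 * n ^ 3 * I.L ^ 2 * C I r ^ 2 / B I r ≤ I.ε ^ 2 / (32 * Real.log (6 / I.δ)) := by
  have hB := hI.B_pos r
  have hn := hI.n_pos
  have hL := hI.L_pos'
  have hε := hI.ε_pos
  have hl := hI.log_pos
  have h6 := hI.log_six_pos
  set ℓ := Real.log (12 * n / I.δ) with hℓ
  have hBr : B I r = 17 * I.L * (n : ℝ) ^ 2 / I.ε * ℓ * 2 ^ r := rfl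
  have hr4 : (r : ℝ) * 4 ≤ (2 ^ r) ^ 2 := by
    have h : r * 4 ≤ 4 ^ r := by
      clear hBr hB
      induction r, hr using Nat.le_induction with
      | base => norm_num
      | succ k hk ih => rw [pow_succ]; omega
    rw [← pow_mul, mul_comm r 2, pow_mul]
    norm_num
    exact_mod_cast h
  calc 8 * n ^ 3 * I.L ^ 2 * C I r ^ 2 / B I r
      ≤ 8 * n ^ 3 * I.L ^ 2 * (2 * n * r * ℓ / B I r) / B I r := by
        gcongr; exact hI.sq_C_le hr
    _ = 16 * I.ε ^ 2 * r / (289 * ℓ * (2 ^ r) ^ 2) := by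
        rw [hBr]; field_simp; ring
    _ ≤ 16 * I.ε ^ 2 * r / (289 * ℓ * (r * 4)) := by
        have : (0 : ℝ) < r := by exact_mod_cast hr
        gcongr
    _ = I.ε ^ 2 / (289 / 4 * ℓ) := by
        have : (0 : ℝ) < r := by exact_mod_cast hr
        field_simp; ring
    _ ≤ I.ε ^ 2 / (32 * Real.log (6 / I.δ)) := by
        have := hI.log_six_le
        gcongr
        norm_num

/-! ### Termination and number of pulls -/

/-- All confidence boxes contain the mean vector. -/
def Confident (I : Input n) (μ : EuclideanSpace ℝ (Fin n)) (X : Fin n → ℕ → ℝ) : Prop :=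
  ∀ r, 1 ≤ r → μ ∈ box (muHat I X r) (C I r)

lemma Input.Valid.stopCond_of_le_B (hI : I.Valid) {r : ℕ} (hr : 1 ≤ r)
    (hμ : μ ∈ box (muHat I X r) (C I r))
    (hB : 64 * (∑ i, |gradient I.f μ i|) ^ 2 * Real.log (6 / I.δ) / I.ε ^ 2 ≤ B I r) :
    StopCond I X r := by
  have h6 := hI.log_six_pos
  have hε := hI.ε_pos
  have hB0 := hI.B_pos r
  have h0 : 0 ≤ ∑ i, gL I X r i := Finset.sum_nonneg fun j _ => gL_nonneg r j
  have h1 : ∑ i, gL I X r i ≤ ∑ i, |gradient I.f μ i| :=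
    Finset.sum_le_sum fun i _ => gL_le hμ i
  have h2 : 2 * (∑ i, gL I X r i) ^ 2 / B I r ≤ I.ε ^ 2 / (32 * Real.log (6 / I.δ)) := by
    calc 2 * (∑ i, gL I X r i) ^ 2 / B I r ≤ 2 * (∑ i, |gradient I.f μ i|) ^ 2 / B I r := by
          gcongr
      _ ≤ _ := by
          rw [div_le_div_iff₀ hB0 (by positivity)]
          rw [div_le_iff₀ (by positivity)] at hB
          linarith
  have h3 := hI.sum_sq_gU_div_le (X := X) r
  have h4 := hI.box_term_le hr
  have h5 : I.ε ^ 2 / (16 * Real.log (6 / I.δ)) =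
      I.ε ^ 2 / (32 * Real.log (6 / I.δ)) + I.ε ^ 2 / (32 * Real.log (6 / I.δ)) := by
    field_simp; norm_num
  unfold StopCond
  linarith

/-- Among the rounds there is one whose budget reaches `M` without exceeding `M` and `B₀` by more
than a constant factor. -/
lemma Input.Valid.exists_le_B (hI : I.Valid) {M : ℝ} (hM : 0 ≤ M) :
    ∃ r, 1 ≤ r ∧ M ≤ B I r ∧ B I r ≤ 2 * B₀ I + 2 * M := by
  classical
  have hB := hI.B₀_pos
  have hex : ∃ r, 1 ≤ r ∧ M ≤ B I r := by
    obtain ⟨k, hk⟩ := pow_unbounded_of_one_lt (M / B₀ I) (one_lt_two (α := ℝ))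
    refine ⟨k + 1, by omega, ?_⟩
    rw [div_lt_iff₀ hB] at hk
    unfold B
    rw [pow_succ]
    nlinarith
  refine ⟨Nat.find hex, (Nat.find_spec hex).1, (Nat.find_spec hex).2, ?_⟩
  rcases (Nat.find_spec hex).1.eq_or_lt with h | h
  · rw [← h]
    unfold B
    linarith
  · obtain ⟨k, hk⟩ : ∃ k, Nat.find hex = k + 1 := ⟨Nat.find hex - 1, by omega⟩
    have hkB : ¬ (1 ≤ k ∧ M ≤ B I k) := Nat.find_min hex (by omega)
    have : B I k < M := by
      by_contra hc
      exact hkB ⟨by omega, not_lt.1 hc⟩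
    rw [hk]
    unfold B at this ⊢
    rw [pow_succ]
    linarith

/-- On the confidence event the algorithm stops, at a budget of the claimed order. -/
lemma Input.Valid.exists_stopsAt (hI : I.Valid) (hX : Confident I μ X) :
    ∃ r, StopsAt I X r ∧ B I r ≤ 2 * B₀ I +
      2 * (64 * (∑ i, |gradient I.f μ i|) ^ 2 * Real.log (6 / I.δ) / I.ε ^ 2) := by
  classical
  have h6 := hI.log_six_pos
  obtain ⟨s, hs, hM, hBs⟩ := hI.exists_le_B
    (M := 64 * (∑ i, |gradient I.f μ i|) ^ 2 * Real.log (6 / I.δ) / I.ε ^ 2) (by positivity)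
  have hex : ∃ r, 1 ≤ r ∧ StopCond I X r := ⟨s, hs, hI.stopCond_of_le_B hs (hX s hs) hM⟩
  refine ⟨Nat.find hex, ⟨(Nat.find_spec hex).1, (Nat.find_spec hex).2,
    fun t ht htr hc => Nat.find_min hex htr ⟨ht, hc⟩⟩, le_trans ?_ hBs⟩
  have hle : Nat.find hex ≤ s := Nat.find_min' hex ⟨hs, hI.stopCond_of_le_B hs (hX s hs) hM⟩
  have := hI.B₀_pos
  unfold B
  gcongr
  norm_num

lemma Input.Valid.uniformPulls_le (hI : I.Valid) (r : ℕ) :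
    (uniformPulls I r : ℝ) ≤ 2 * B I r / n + r := by
  have hn := hI.n_pos
  have hB := hI.B₀_pos
  induction r with
  | zero => simp [uniformPulls]; have := hI.B_pos 0; positivity
  | succ k ih =>
    have h : uniformPulls I (k + 1) = uniformPulls I k + ⌈B I (k + 1) / n⌉₊ := by
      unfold uniformPulls
      exact Finset.sum_Icc_succ_top (by omega) _
    have h1 := Nat.ceil_lt_add_one (div_pos (hI.B_pos (k + 1)) hn).le
    have h2 : 2 * B I k = B I (k + 1) := by unfold B; ring
    have h3 : 2 * B I (k + 1) / n = B I (k + 1) / n + B I (k + 1) / n := by ring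
    rw [h, h3]
    rw [h2] at ih
    push_cast
    linarith

/-- If `B₀ ≥ n`, rounding up is negligible, and a run takes a number of pulls of the order of the
budget of its last round. -/
lemma Input.Valid.totalPulls_le (hI : I.Valid) (hnB : (n : ℝ) ≤ B₀ I) (r : ℕ) :
    (totalPulls I X r : ℝ) ≤ 6 * B I r := by
  have hn := hI.n_pos
  have hr : n * (r : ℝ) ≤ B I r := by
    have h : (r : ℝ) ≤ 2 ^ r := by exact_mod_cast Nat.lt_two_pow_self.le
    have := hI.B₀_pos
    unfold B
    gcongr
  have hn' : (n : ℝ) ≤ B I r := by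
    have h : (1 : ℝ) ≤ 2 ^ r := one_le_pow₀ one_le_two
    unfold B
    nlinarith
  have h1 : n * (uniformPulls I r : ℝ) ≤ 2 * B I r + n * r := by
    calc n * (uniformPulls I r : ℝ) ≤ n * (2 * B I r / n + r) := by
          gcongr; exact hI.uniformPulls_le r
      _ = _ := by field_simp
  have h2 : ∑ i, (finalPulls I X r i : ℝ) ≤ 2 * B I r + n := by
    calc ∑ i, (finalPulls I X r i : ℝ) ≤ ∑ i, ((alpha I X r i + 1 / n) * B I r + 1) := by
          refine Finset.sum_le_sum fun i _ => (Nat.ceil_lt_add_one ?_).le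
          have := (hI.alpha_mem (X := X) r).1 i
          have := hI.B_pos r
          positivity
      _ = (∑ i, alpha I X r i + 1) * B I r + n := by
          rw [Finset.sum_add_distrib, ← Finset.sum_mul, Finset.sum_add_distrib]
          simp [hn.ne']
      _ = 2 * B I r + n := by rw [(hI.alpha_mem r).2]; ring
  unfold totalPulls
  push_cast
  rw [Finset.sum_add_distrib]
  simp only [Finset.sum_const, Finset.card_univ, Fintype.card_fin, nsmul_eq_mul]
  linarith

/-! ### Accuracy of the output -/

/-- Quadratic bound for the error of the first-order expansion of a function with Lipschitz
gradient (the optimal constant would be `L / 2`). -/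
lemma abs_sub_sub_sum_gradient_le {n : ℕ} {f : EuclideanSpace ℝ (Fin n) → ℝ} {L : ℝ≥0}
    (hf : Differentiable ℝ f) (hL : LipschitzWith L (gradient f))
    (x y : EuclideanSpace ℝ (Fin n)) :
    |f y - f x - ∑ i, gradient f x i * (y i - x i)| ≤ L * ‖y - x‖ ^ 2 := by
  have hgrad : ∀ z, HasFDerivAt f (InnerProductSpace.toDual ℝ _ (gradient f z)) z :=
    fun z => (hf z).hasGradientAt.hasFDerivAt
  have h := (convex_closedBall x ‖y - x‖).norm_image_sub_le_of_norm_hasFDerivWithin_le'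
    (f := f) (φ := InnerProductSpace.toDual ℝ _ (gradient f x)) (C := L * ‖y - x‖)
    (fun z _ => (hgrad z).hasFDerivWithinAt) (fun z hz => ?_)
    (Metric.mem_closedBall_self (norm_nonneg _)) (y := y) (by simp [dist_eq_norm])
  · have hin : InnerProductSpace.toDual ℝ _ (gradient f x) (y - x) =
        ∑ i, gradient f x i * (y i - x i) := by
      rw [InnerProductSpace.toDual_apply_apply, PiLp.inner_apply]
      simp [mul_comm]
    rw [hin, Real.norm_eq_abs] at h
    exact h.trans (le_of_eq (by ring))
  · rw [← map_sub, LinearIsometryEquiv.norm_map]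
    have hz' : ‖z - x‖ ≤ ‖y - x‖ := by simpa [dist_eq_norm] using hz
    exact (hL.norm_sub_le z x).trans (by gcongr)

/-- The average of the `T` consecutive terms of `z` that start with index `u`. -/
noncomputable def noise (u T : ℕ) (z : ℕ → ℝ) : ℝ :=
  (∑ k ∈ Finset.range T, z (u + k)) / T

lemma sum_shift_div_sub (m : ℝ) (u : ℕ) {T : ℕ} (hT : (0 : ℝ) < T) (z : ℕ → ℝ) :
    (∑ k ∈ Finset.range T, (m + z (u + k))) / T - m = noise u T z := by
  rw [noise, Finset.sum_add_distrib]
  simp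
  field_simp
  ring

/-- The outcomes of the pulls when the means are `μ` and the noise is `z`. -/
def shift (μ : EuclideanSpace ℝ (Fin n)) (z : Fin n → ℕ → ℝ) : Fin n → ℕ → ℝ :=
  fun i k => μ i + z i k

/-- The event that the noise of a final phase with `T i` pulls of arm `i`, starting at index `u`,
is large: in the direction of the gradient, or in some coordinate. -/
def FinalBad (I : Input n) (μ : EuclideanSpace ℝ (Fin n)) (u : ℕ) (T : Fin n → ℕ)
    (z : Fin n → ℕ → ℝ) : Prop :=
  I.ε / 2 < |∑ i, gradient I.f μ i * noise u (T i) (z i)| ∨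
    ∃ i, Real.sqrt (2 * Real.log (12 * n / I.δ) / T i) < |noise u (T i) (z i)|

/-- The linear part of the error is at most `ε / 2` by assumption. The quadratic part is at most
`ε / 17`, because each arm is pulled at least `B r / n ≥ 2 B₀ / n` times in the final phase. -/
lemma Input.Valid.abs_sub_le_of_not_finalBad (hI : I.Valid) {r : ℕ} (hr : 1 ≤ r)
    {z : Fin n → ℕ → ℝ}
    (h : ¬ FinalBad I μ (uniformPulls I r) (finalPulls I (shift μ z) r) z) :
    |I.f (muTilde I (shift μ z) r) - I.f μ| ≤ I.ε := by
  have hn := hI.n_pos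
  have hε := hI.ε_pos
  have hL := hI.L_pos'
  have hl := hI.log_pos
  have hB := hI.B₀_pos
  unfold FinalBad at h
  push Not at h
  obtain ⟨hlin, hquad⟩ := h
  have hnoise : ∀ i, muTilde I (shift μ z) r i - μ i =
      noise (uniformPulls I r) (finalPulls I (shift μ z) r i) (z i) :=
    fun i => sum_shift_div_sub _ _ (hI.finalPulls_pos r i) _
  have htaylor := abs_sub_sub_sum_gradient_le hI.differentiable hI.lipschitz μ
    (muTilde I (shift μ z) r)
  simp only [hnoise] at htaylor
  have hsq : ∀ i, (muTilde I (shift μ z) r i - μ i) ^ 2 ≤ I.ε / (17 * I.L * n) := by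
    intro i
    have hT := hI.finalPulls_pos (X := shift μ z) r i
    have h1 : 2 * B₀ I / n ≤ finalPulls I (shift μ z) r i :=
      le_trans (by gcongr; exact hI.two_mul_B₀_le_B hr) (hI.B_div_le_finalPulls r i)
    rw [hnoise, ← sq_abs]
    calc |noise (uniformPulls I r) (finalPulls I (shift μ z) r i) (z i)| ^ 2
        ≤ Real.sqrt (2 * Real.log (12 * n / I.δ) / finalPulls I (shift μ z) r i) ^ 2 := by
          gcongr; exact hquad i
      _ = 2 * Real.log (12 * n / I.δ) / finalPulls I (shift μ z) r i :=
          Real.sq_sqrt (by positivity)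
      _ ≤ 2 * Real.log (12 * n / I.δ) / (2 * B₀ I / n) := by gcongr
      _ = I.ε / (17 * I.L * n) := by unfold B₀; field_simp
  have hnorm : I.L * ‖muTilde I (shift μ z) r - μ‖ ^ 2 ≤ I.ε / 17 := by
    rw [EuclideanSpace.norm_sq_eq]
    calc I.L * ∑ i, ‖(muTilde I (shift μ z) r - μ) i‖ ^ 2
        ≤ I.L * ∑ _i : Fin n, I.ε / (17 * I.L * n) := by
          gcongr with i
          simpa using hsq i
      _ = I.ε / 17 := by simp; field_simp
  have h1 := abs_le.1 hlin
  have h2 := abs_le.1 (htaylor.trans hnorm)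
  exact abs_le.2 ⟨by linarith, by linarith⟩

/-! ### Probability of large noise -/

section Noise

variable {Ω : Type*} [MeasurableSpace Ω] {P : Measure Ω} {Z : Fin n → ℕ → Ω → ℝ}

lemma measure_lt_abs_sum_noise_le (hind : iIndepFun (fun p : Fin n × ℕ => Z p.1 p.2) P)
    (hZ : ∀ i k, P.map (Z i k) = gaussianReal 0 1) (u : ℕ) (T : Fin n → ℕ) (g : Fin n → ℝ)
    {v t x : ℝ} (hv : 0 < v) (hg : ∑ i, g i ^ 2 / T i ≤ v) (ht : 0 ≤ t)
    (hx : 2 * v * x ≤ t ^ 2) :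
    P {ω | t < |∑ i, g i * noise u (T i) (fun k => Z i k ω)|} ≤
      ENNReal.ofReal (2 * Real.exp (-x)) := by
  have hinj : Function.Injective fun p : (_ : Fin n) × ℕ => (p.1, u + p.2) := by
    rintro ⟨i, k⟩ ⟨j, l⟩ h
    simp only [Prod.mk.injEq, add_right_inj] at h
    obtain ⟨rfl, rfl⟩ := h
    rfl
  have h := measure_lt_abs_sum_le (P := P) (hind.precomp hinj) (fun p => hZ p.1 (u + p.2))
    (Finset.univ.sigma fun i => Finset.range (T i)) (fun p => g p.1 / T p.1) hv ?_ ht hx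
  · convert h using 7 with ω
    rw [Finset.sum_sigma]
    refine Finset.sum_congr rfl fun i _ => ?_
    simp only [noise]
    rw [← Finset.mul_sum]
    ring
  · rw [Finset.sum_sigma]
    refine le_trans (le_of_eq (Finset.sum_congr rfl fun i _ => ?_)) hg
    rcases Nat.eq_zero_or_pos (T i) with h0 | h0
    · simp [h0]
    · have : (0 : ℝ) < T i := by exact_mod_cast h0
      simp
      field_simp

lemma measure_lt_abs_noise_le (hind : iIndepFun (fun p : Fin n × ℕ => Z p.1 p.2) P)
    (hZ : ∀ i k, P.map (Z i k) = gaussianReal 0 1) (u : ℕ) {T : ℕ} (hT : (0 : ℝ) < T)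
    {x : ℝ} (hx : 0 ≤ x) (i : Fin n) :
    P {ω | Real.sqrt (2 * x / T) < |noise u T (fun k => Z i k ω)|} ≤
      ENNReal.ofReal (2 * Real.exp (-x)) := by
  have h := measure_lt_abs_sum_noise_le hind hZ u (fun _ => T) (Pi.single i 1) (v := 1 / T)
    (t := Real.sqrt (2 * x / T)) (x := x) (by positivity) ?_ (Real.sqrt_nonneg _) ?_
  · simpa [Pi.single_apply, ite_mul] using h
  · simp [Pi.single_apply, ite_pow, ite_div]
  · rw [Real.sq_sqrt (by positivity)]
    exact le_of_eq (by ring)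

/-- A union bound: the confidence boxes fail with probability at most `δ / (6 n r ^ 2)` per arm and
round. -/
lemma Input.Valid.measure_not_confident_le (hI : I.Valid)
    (hind : iIndepFun (fun p : Fin n × ℕ => Z p.1 p.2) P)
    (hZ : ∀ i k, P.map (Z i k) = gaussianReal 0 1) :
    P {ω | ¬ Confident I μ (shift μ fun i k => Z i k ω)} ≤ ENNReal.ofReal (I.δ / 2) := by
  have hδ := hI.δ_pos
  have hn := hI.n_pos
  have hsub : {ω | ¬ Confident I μ (shift μ fun i k => Z i k ω)} ⊆
      ⋃ r : ℕ, ⋃ i : Fin n, {ω | 1 ≤ r ∧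
        C I r < |noise 0 (uniformPulls I r) (fun k => Z i k ω)|} := by
    intro ω hω
    have hω' : ¬ Confident I μ (shift μ fun i k => Z i k ω) := hω
    unfold Confident at hω'
    push Not at hω'
    obtain ⟨r, hr, hb⟩ := hω'
    have hb' : ¬ ∀ i, |μ i - muHat I (shift μ fun i k => Z i k ω) r i| ≤ C I r := hb
    push Not at hb'
    obtain ⟨i, hi⟩ := hb'
    refine Set.mem_iUnion₂.2 ⟨r, i, hr, ?_⟩
    have h := sum_shift_div_sub (μ i) 0 (hI.uniformPulls_pos hr) (fun k => Z i k ω)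
    rw [abs_sub_comm] at hi
    rw [← h]
    simpa [muHat, shift] using hi
  have hr : ∀ (r : ℕ) (i : Fin n), P {ω | 1 ≤ r ∧
      C I r < |noise 0 (uniformPulls I r) (fun k => Z i k ω)|} ≤
        ENNReal.ofReal (I.δ / (6 * n) * (1 / (r : ℝ) ^ 2)) := by
    intro r i
    by_cases hr : 1 ≤ r
    · have hr0 : (0 : ℝ) < r := by exact_mod_cast hr
      have h := measure_lt_abs_noise_le hind hZ 0 (hI.uniformPulls_pos hr)
        (hI.log_round_pos hr).le i
      rw [Real.exp_neg, Real.exp_log (by positivity)] at h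
      simp only [hr, true_and]
      refine h.trans (ENNReal.ofReal_le_ofReal (le_of_eq ?_))
      field_simp
      norm_num
    · simp [hr]
  have hsum := hasSum_zeta_two.mul_left (I.δ / 6)
  calc P {ω | ¬ Confident I μ (shift μ fun i k => Z i k ω)}
      ≤ ∑' r : ℕ, ∑ _i : Fin n, ENNReal.ofReal (I.δ / (6 * n) * (1 / (r : ℝ) ^ 2)) := by
        refine (measure_mono hsub).trans ((measure_iUnion_le _).trans ?_)
        refine ENNReal.tsum_le_tsum fun r => ?_
        refine (measure_iUnion_fintype_le _ _).trans ?_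
        exact Finset.sum_le_sum fun i _ => hr r i
    _ = ∑' r : ℕ, ENNReal.ofReal (I.δ / 6 * (1 / (r : ℝ) ^ 2)) := by
        congr 1 with r
        rw [← ENNReal.ofReal_sum_of_nonneg fun i _ => by positivity]
        congr 1
        simp only [Finset.sum_const, Finset.card_univ, Fintype.card_fin, nsmul_eq_mul]
        field_simp
    _ = ENNReal.ofReal (I.δ / 6 * (Real.pi ^ 2 / 6)) := by
        rw [← ENNReal.ofReal_tsum_of_nonneg (fun r => by positivity) hsum.summable, hsum.tsum_eq]
    _ ≤ ENNReal.ofReal (I.δ / 2) := by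
        refine ENNReal.ofReal_le_ofReal ?_
        have h1 : Real.pi ^ 2 ≤ 4 ^ 2 := by
          gcongr
          exact Real.pi_le_four
        nlinarith

lemma Input.Valid.measure_finalBad_le (hI : I.Valid)
    (hind : iIndepFun (fun p : Fin n × ℕ => Z p.1 p.2) P)
    (hZ : ∀ i k, P.map (Z i k) = gaussianReal 0 1) (u : ℕ) {T : Fin n → ℕ}
    (hT : ∀ i, (0 : ℝ) < T i)
    (hv : ∑ i, gradient I.f μ i ^ 2 / T i ≤ I.ε ^ 2 / (16 * Real.log (6 / I.δ))) :
    P {ω | FinalBad I μ u T (fun i k => Z i k ω)} ≤ ENNReal.ofReal (I.δ / 2) := by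
  have hδ := hI.δ_pos
  have hn := hI.n_pos
  have hε := hI.ε_pos
  have h6 := hI.log_six_pos
  have h1 : P {ω | I.ε / 2 < |∑ i, gradient I.f μ i * noise u (T i) (fun k => Z i k ω)|} ≤
      ENNReal.ofReal (2 * (6 / I.δ)⁻¹) := by
    have h := measure_lt_abs_sum_noise_le hind hZ u T (fun i => gradient I.f μ i) (t := I.ε / 2)
      (x := Real.log (6 / I.δ)) (by positivity) hv (by positivity)
      (by field_simp; norm_num)
    rwa [Real.exp_neg, Real.exp_log (by positivity)] at h
  have h2 : ∀ i, P {ω | Real.sqrt (2 * Real.log (12 * n / I.δ) / T i) <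
      |noise u (T i) (fun k => Z i k ω)|} ≤ ENNReal.ofReal (2 * (12 * n / I.δ)⁻¹) := by
    intro i
    have h := measure_lt_abs_noise_le hind hZ u (hT i) hI.log_pos.le i
    rwa [Real.exp_neg, Real.exp_log (by positivity)] at h
  have hsub : {ω | FinalBad I μ u T (fun i k => Z i k ω)} ⊆
      {ω | I.ε / 2 < |∑ i, gradient I.f μ i * noise u (T i) (fun k => Z i k ω)|} ∪
        ⋃ i, {ω | Real.sqrt (2 * Real.log (12 * n / I.δ) / T i) <
          |noise u (T i) (fun k => Z i k ω)|} := by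
    rintro ω (h | ⟨i, h⟩)
    · exact Or.inl h
    · exact Or.inr (Set.mem_iUnion.2 ⟨i, h⟩)
  calc P {ω | FinalBad I μ u T (fun i k => Z i k ω)}
      ≤ ENNReal.ofReal (2 * (6 / I.δ)⁻¹) +
          ∑ _i : Fin n, ENNReal.ofReal (2 * (12 * n / I.δ)⁻¹) := by
        refine (measure_mono hsub).trans ((measure_union_le _ _).trans (add_le_add h1 ?_))
        exact (measure_iUnion_fintype_le _ _).trans (Finset.sum_le_sum fun i _ => h2 i)
    _ = ENNReal.ofReal (I.δ / 2) := by
        rw [← ENNReal.ofReal_sum_of_nonneg fun i _ => by positivity,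
          ← ENNReal.ofReal_add (by positivity) (Finset.sum_nonneg fun i _ => by positivity)]
        congr 1
        simp only [Finset.sum_const, Finset.card_univ, Fintype.card_fin, nsmul_eq_mul]
        field_simp
        norm_num

end Noise

/-! ### The stopping rule as a function of the past -/

lemma uniformPulls_mono : Monotone (uniformPulls I) := fun _ _ h =>
  Finset.sum_le_sum_of_subset (Finset.Icc_subset_Icc_right h)

lemma muHat_congr {X X' : Fin n → ℕ → ℝ} {r s : ℕ} (hs : s ≤ r)
    (h : ∀ i, ∀ k < uniformPulls I r, X i k = X' i k) : muHat I X s = muHat I X' s := by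
  unfold muHat
  congr 1
  funext i
  congr 1
  exact Finset.sum_congr rfl fun k hk =>
    h i k ((Finset.mem_range.1 hk).trans_le (uniformPulls_mono hs))

lemma finalPulls_congr {X X' : Fin n → ℕ → ℝ} {s : ℕ} (h : muHat I X s = muHat I X' s) :
    finalPulls I X s = finalPulls I X' s := by
  funext i
  simp only [finalPulls, alpha, gL, h]

lemma stopCond_congr {X X' : Fin n → ℕ → ℝ} {s : ℕ} (h : muHat I X s = muHat I X' s) :
    StopCond I X s ↔ StopCond I X' s := by
  simp only [StopCond, finalPulls_congr h, gU, h]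

lemma stopsAt_congr {X X' : Fin n → ℕ → ℝ} {r : ℕ}
    (h : ∀ i, ∀ k < uniformPulls I r, X i k = X' i k) : StopsAt I X r ↔ StopsAt I X' r := by
  unfold StopsAt
  rw [stopCond_congr (muHat_congr le_rfl h)]
  refine and_congr_right fun _ => and_congr_right fun _ => forall_congr' fun s =>
    forall_congr' fun _ => forall_congr' fun hs => not_congr ?_
  exact stopCond_congr (muHat_congr hs.le h)

lemma StopsAt.unique {X : Fin n → ℕ → ℝ} {r s : ℕ} (hr : StopsAt I X r) (hs : StopsAt I X s) :
    r = s := by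
  rcases lt_trichotomy r s with h | h | h
  · exact absurd hr.2.1 (hs.2.2 r hr.1 h)
  · exact h
  · exact absurd hs.2.1 (hr.2.2 s hs.1 h)

lemma measurable_muHat (r : ℕ) : Measurable fun X : Fin n → ℕ → ℝ => muHat I X r := by
  refine (PiLp.continuous_toLp 2 _).measurable.comp (measurable_pi_lambda _ fun i => ?_)
  refine Measurable.div_const (Finset.measurable_sum _ fun k _ => ?_) _
  exact (measurable_pi_apply k).comp (measurable_pi_apply i)

/-- The extrema of a continuous function over a translate of a fixed compact box depend
continuously on the translation. -/
lemma Input.Valid.measurable_gL (hI : I.Valid) (r : ℕ) (i : Fin n) :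
    Measurable fun X : Fin n → ℕ → ℝ => gL I X r i := by
  have hc : Continuous fun m => sInf ((fun z => |gradient I.f (m + z) i|) '' box 0 (C I r)) := by
    refine (isCompact_box 0 (C I r)).continuous_sInf ?_
    exact (hI.continuous_abs_gradient i).comp (continuous_fst.add continuous_snd)
  have h : (fun X : Fin n → ℕ → ℝ => gL I X r i) = fun X =>
      sInf ((fun z => |gradient I.f (muHat I X r + z) i|) '' box 0 (C I r)) := by
    funext X
    rw [gL, box_eq_image, Set.image_image]
  rw [h]
  exact hc.measurable.comp (measurable_muHat r)

lemma Input.Valid.measurable_gU (hI : I.Valid) (r : ℕ) (i : Fin n) :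
    Measurable fun X : Fin n → ℕ → ℝ => gU I X r i := by
  have hc : Continuous fun m => sSup ((fun z => |gradient I.f (m + z) i|) '' box 0 (C I r)) := by
    refine (isCompact_box 0 (C I r)).continuous_sSup ?_
    exact (hI.continuous_abs_gradient i).comp (continuous_fst.add continuous_snd)
  have h : (fun X : Fin n → ℕ → ℝ => gU I X r i) = fun X =>
      sSup ((fun z => |gradient I.f (muHat I X r + z) i|) '' box 0 (C I r)) := by
    funext X
    rw [gU, box_eq_image, Set.image_image]
  rw [h]
  exact hc.measurable.comp (measurable_muHat r)

lemma Input.Valid.measurable_finalPulls (hI : I.Valid) (r : ℕ) (i : Fin n) :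
    Measurable fun X : Fin n → ℕ → ℝ => finalPulls I X r i := by
  have hsum : Measurable fun X : Fin n → ℕ → ℝ => ∑ j, gL I X r j :=
    Finset.measurable_sum _ fun j _ => hI.measurable_gL r j
  refine Nat.measurable_ceil.comp (Measurable.mul_const (Measurable.add_const ?_ _) _)
  exact Measurable.ite (hsum (measurableSet_singleton 0)) measurable_const
    ((hI.measurable_gL r i).div hsum)

lemma Input.Valid.measurableSet_stopCond (hI : I.Valid) (r : ℕ) :
    MeasurableSet {X : Fin n → ℕ → ℝ | StopCond I X r} := by
  refine measurableSet_le (Finset.measurable_sum _ fun i _ => ?_) measurable_const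
  exact ((hI.measurable_gU r i).pow_const 2).div
    (measurable_from_top.comp (hI.measurable_finalPulls r i))

lemma Input.Valid.measurableSet_stopsAt (hI : I.Valid) (r : ℕ) :
    MeasurableSet {X : Fin n → ℕ → ℝ | StopsAt I X r} := by
  refine (MeasurableSet.const _).inter ((hI.measurableSet_stopCond r).inter ?_)
  have h : {X : Fin n → ℕ → ℝ | ∀ s, 1 ≤ s → s < r → ¬ StopCond I X s} =
      ⋂ s, ⋂ (_ : 1 ≤ s), ⋂ (_ : s < r), {X | StopCond I X s}ᶜ := by
    ext X; simp
  change MeasurableSet {X : Fin n → ℕ → ℝ | ∀ s, 1 ≤ s → s < r → ¬ StopCond I X s}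
  rw [h]
  exact MeasurableSet.iInter fun s => MeasurableSet.iInter fun _ => MeasurableSet.iInter fun _ =>
    (hI.measurableSet_stopCond s).compl

lemma measurable_noise (u T : ℕ) (i : Fin n) :
    Measurable fun z : Fin n → ℕ → ℝ => noise u T (z i) := by
  refine Measurable.div_const (Finset.measurable_sum _ fun k _ => ?_) _
  exact (measurable_pi_apply (u + k)).comp (measurable_pi_apply i)

lemma measurableSet_finalBad (u : ℕ) (T : Fin n → ℕ) :
    MeasurableSet {z : Fin n → ℕ → ℝ | FinalBad I μ u T z} := by
  have hlin : Measurable fun z : Fin n → ℕ → ℝ =>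
      |∑ i, gradient I.f μ i * noise u (T i) (z i)| :=
    measurable_norm.comp
      (Finset.measurable_sum _ fun i _ => (measurable_noise u (T i) i).const_mul _)
  have hcoord : {z : Fin n → ℕ → ℝ | ∃ i, Real.sqrt (2 * Real.log (12 * n / I.δ) / T i) <
      |noise u (T i) (z i)|} = ⋃ i, {z | Real.sqrt (2 * Real.log (12 * n / I.δ) / T i) <
      |noise u (T i) (z i)|} := by
    ext z; simp
  refine (measurableSet_lt measurable_const hlin).union ?_
  change MeasurableSet {z : Fin n → ℕ → ℝ | ∃ i, _ < _}
  rw [hcoord]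
  exact MeasurableSet.iUnion fun i =>
    measurableSet_lt measurable_const (measurable_norm.comp (measurable_noise u (T i) i))

lemma finalBad_congr {z z' : Fin n → ℕ → ℝ} {u : ℕ} (T : Fin n → ℕ)
    (h : ∀ i k, u ≤ k → z i k = z' i k) : FinalBad I μ u T z ↔ FinalBad I μ u T z' := by
  have h' : ∀ i, noise u (T i) (z i) = noise u (T i) (z' i) := fun i => by
    unfold noise
    congr 1
    exact Finset.sum_congr rfl fun k _ => h i _ (Nat.le_add_right _ _)
  simp only [FinalBad, h']

/-! ### The exceptional event -/

/-- The noise of the final phase is large although the final phase has an admissible variance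
proxy. -/
def ExceptionalFinal (I : Input n) (μ : EuclideanSpace ℝ (Fin n)) (r : ℕ) (T : Fin n → ℕ)
    (z : Fin n → ℕ → ℝ) : Prop :=
  (∀ i, (0 : ℝ) < T i) ∧
    ∑ i, gradient I.f μ i ^ 2 / T i ≤ I.ε ^ 2 / (16 * Real.log (6 / I.δ)) ∧
      FinalBad I μ (uniformPulls I r) T z

/-- The stopping round and the numbers of final pulls are functions of the past, and the noise of
the final phase is independent of the past. Hence the data-dependent choice of the final phase
does not increase the probability that its noise is large. -/
lemma Input.Valid.measure_exceptional_le (hI : I.Valid) {Ω : Type*} [MeasurableSpace Ω]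
    {P : Measure Ω} [IsProbabilityMeasure P] {Z : Fin n → ℕ → Ω → ℝ}
    (hmeas : ∀ i k, Measurable (Z i k))
    (hZ : ∀ i k, P.map (Z i k) = gaussianReal 0 1)
    (hind : iIndepFun (fun p : Fin n × ℕ => Z p.1 p.2) P) :
    P (⋃ j : ℕ × (Fin n → ℕ),
      {ω | StopsAt I (shift μ fun i k => Z i k ω) j.1 ∧
        finalPulls I (shift μ fun i k => Z i k ω) j.1 = j.2} ∩
      {ω | ExceptionalFinal I μ j.1 j.2 fun i k => Z i k ω}) ≤ ENNReal.ofReal (I.δ / 2) := by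
  have hshift : Measurable (shift μ) := by
    refine measurable_pi_lambda _ fun i => measurable_pi_lambda _ fun k => ?_
    have h : Measurable fun z : Fin n → ℕ → ℝ => z i k :=
      (measurable_pi_apply k).comp (measurable_pi_apply i)
    exact h.const_add _
  have hZm : Measurable fun ω i k => Z i k ω :=
    measurable_pi_lambda _ fun i => measurable_pi_lambda _ fun k => hmeas i k
  have hA : ∀ j : ℕ × (Fin n → ℕ), MeasurableSet {z : Fin n → ℕ → ℝ |
      StopsAt I (shift μ z) j.1 ∧ finalPulls I (shift μ z) j.1 = j.2} := by
    intro j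
    have hT : Measurable fun X : Fin n → ℕ → ℝ => finalPulls I X j.1 :=
      measurable_pi_lambda _ fun i => hI.measurable_finalPulls j.1 i
    exact hshift ((hI.measurableSet_stopsAt j.1).inter (hT (measurableSet_singleton j.2)))
  refine measure_iUnion_inter_le (fun j => hZm (hA j)) ?_ ?_ ?_
  · rintro ⟨r, T⟩ ⟨s, T'⟩ hne
    refine Set.disjoint_left.2 ?_
    rintro ω ⟨h1, h2⟩ ⟨h3, h4⟩
    obtain rfl : r = s := h1.unique h3
    exact hne (congrArg (Prod.mk r) (h2.symm.trans h4))
  · rintro ⟨r, T⟩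
    refine measure_inter_of_past_future hmeas hind (uniformPulls I r) (hA (r, T))
      (D := {z | ExceptionalFinal I μ r T z}) ?_ ?_ ?_
    · exact (MeasurableSet.const _).inter ((MeasurableSet.const _).inter
        (measurableSet_finalBad _ _))
    · intro z z' h
      have h' : ∀ i, ∀ k < uniformPulls I r, shift μ z i k = shift μ z' i k :=
        fun i k hk => by simp only [shift, h i k hk]
      exact and_congr (stopsAt_congr h') (by rw [finalPulls_congr (muHat_congr le_rfl h')])
    · intro z z' h
      exact and_congr_right fun _ => and_congr_right fun _ => finalBad_congr T h
  · rintro ⟨r, T⟩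
    by_cases h : (∀ i, (0 : ℝ) < T i) ∧
        ∑ i, gradient I.f μ i ^ 2 / T i ≤ I.ε ^ 2 / (16 * Real.log (6 / I.δ))
    · refine (measure_mono ?_).trans (hI.measure_finalBad_le hind hZ (uniformPulls I r) h.1 h.2)
      exact fun ω hω => hω.2.2
    · have : {ω | ExceptionalFinal I μ r T fun i k => Z i k ω} = ∅ :=
        Set.eq_empty_of_forall_notMem fun ω hω => h ⟨hω.1, hω.2.1⟩
      simp [this]

/-- With probability at least `1 - δ` the algorithm stops, at a budget of the claimed order, and
its output is accurate. -/
lemma Input.Valid.ofReal_one_sub_le (hI : I.Valid) (μ : EuclideanSpace ℝ (Fin n)) {Ω : Type*}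
    [MeasurableSpace Ω] {P : Measure Ω} [IsProbabilityMeasure P] {Z : Fin n → ℕ → Ω → ℝ}
    (hmeas : ∀ i k, Measurable (Z i k))
    (hZ : ∀ i k, P.map (Z i k) = gaussianReal 0 1)
    (hind : iIndepFun (fun p : Fin n × ℕ => Z p.1 p.2) P) :
    ENNReal.ofReal (1 - I.δ) ≤ P {ω | ∃ r, StopsAt I (shift μ fun i k => Z i k ω) r ∧
      B I r ≤ 2 * B₀ I +
        2 * (64 * (∑ i, |gradient I.f μ i|) ^ 2 * Real.log (6 / I.δ) / I.ε ^ 2) ∧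
      |I.f (muTilde I (shift μ fun i k => Z i k ω) r) - I.f μ| ≤ I.ε} := by
  have hδ := hI.δ_pos
  have hbad := (measure_union_le _ _).trans (add_le_add
    (hI.measure_not_confident_le (μ := μ) hind hZ)
    (hI.measure_exceptional_le (μ := μ) hmeas hZ hind))
  rw [← ENNReal.ofReal_add (by positivity) (by positivity), add_halves] at hbad
  refine ofReal_one_sub_le_measure hδ.le (fun ω hω => ?_) hbad
  by_contra hgood
  rw [Set.mem_union, not_or] at hgood
  obtain ⟨hconf, hfinal⟩ := hgood
  have hconf : Confident I μ (shift μ fun i k => Z i k ω) := not_not.1 hconf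
  obtain ⟨r, hr, hB⟩ := hI.exists_stopsAt hconf
  refine hω ⟨r, hr, hB, hI.abs_sub_le_of_not_finalBad hr.1 fun hF => hfinal ?_⟩
  refine Set.mem_iUnion.2 ⟨(r, finalPulls I (shift μ fun i k => Z i k ω) r), ⟨hr, rfl⟩,
    hI.finalPulls_pos r, le_trans (Finset.sum_le_sum fun i _ => ?_) hr.2.1, hF⟩
  have h := hI.le_gU (hconf r hr.1) i
  rw [← sq_abs (gradient I.f μ i)]
  gcongr

/-! ### The main result -/

lemma log_mul_le_five_mul_log {c x : ℝ} (hc0 : 0 < c) (hc : c ≤ 16) (hx : 2 ≤ x) :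
    Real.log (c * x) ≤ 5 * Real.log x := by
  have h1 : Real.log c ≤ 4 * Real.log x := by
    calc Real.log c ≤ Real.log (x ^ 4) := by
          refine Real.log_le_log hc0 (hc.trans ?_)
          calc (16 : ℝ) = 2 ^ 4 := by norm_num
            _ ≤ x ^ 4 := by gcongr
      _ = 4 * Real.log x := by rw [Real.log_pow]; norm_num
  rw [Real.log_mul hc0.ne' (by linarith)]
  linarith

end AdaptiveEval

theorem theorem1 :
    ∃ K : ℝ, 0 < K ∧
      ∀ (n : ℕ) (_ : 1 ≤ n)
        (f : EuclideanSpace ℝ (Fin n) → ℝ) (L : ℝ≥0) (_ : 0 < L)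
        (_ : Differentiable ℝ f) (_ : LipschitzWith L (gradient f))
        (μ : EuclideanSpace ℝ (Fin n))
        (ε δ : ℝ) (_ : 0 < ε) (_ : 0 < δ) (_ : δ < 1)
        (q : Fin n → ℝ) (_ : q ∈ stdSimplex ℝ (Fin n))
        (Ω : Type*) [MeasurableSpace Ω] (P : Measure Ω) [IsProbabilityMeasure P]
        (Z : Fin n → ℕ → Ω → ℝ)
        (_ : ∀ i k, Measurable (Z i k))
        (_ : ∀ i k, P.map (Z i k) = gaussianReal 0 1)
        (_ : iIndepFun (fun p : Fin n × ℕ => Z p.1 p.2) P),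
        let I : AdaptiveEval.Input n := ⟨f, L, ε, δ, q⟩
        let X : Ω → Fin n → ℕ → ℝ := fun ω i k => μ i + Z i k ω
        let H : ℝ := ∑ i, |gradient f μ i|
        -- the algorithm terminates with an accurate output
        ENNReal.ofReal (1 - δ) ≤
          P {ω | ∃ y N, AdaptiveEval.Returns I (X ω) y N ∧ |y - f μ| ≤ ε} ∧
        -- it does so within the claimed number of pulls
        ((n : ℝ) ≤ AdaptiveEval.B₀ I →
          ENNReal.ofReal (1 - δ) ≤
            P {ω | ∃ y N, AdaptiveEval.Returns I (X ω) y N ∧ |y - f μ| ≤ ε ∧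
              (N : ℝ) ≤ K * (H ^ 2 * Real.log (6 / δ) / ε ^ 2 +
                (n : ℝ) ^ 2 * L * Real.log (12 * n / δ) / ε)}) ∧
        -- for `δ` away from `1` the constants inside the logarithms can be dropped
        ((n : ℝ) ≤ AdaptiveEval.B₀ I → δ ≤ 1 / 2 →
          ENNReal.ofReal (1 - δ) ≤
            P {ω | ∃ y N, AdaptiveEval.Returns I (X ω) y N ∧ |y - f μ| ≤ ε ∧
              (N : ℝ) ≤ K * (H ^ 2 * Real.log (1 / δ) / ε ^ 2 +
                (n : ℝ) ^ 2 * L * Real.log (n / δ) / ε)}) := by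
  -- `6 * 128 = 768` is enough for the first bound on the number of pulls. Replacing the logarithms
  -- in the second one costs a factor of at most `5`.
  refine ⟨5 * 768, by norm_num, ?_⟩
  intro n hn f L hL hf hfL μ ε δ hε hδ hδ1 q hq Ω _ P _ Z hmeas hZ hind I X H
  have hI : I.Valid := ⟨hn, hL, hε, hδ, hδ1, hf, hfL, hq⟩
  have hn1 : (1 : ℝ) ≤ n := hI.one_le_cast
  have hL' : (0 : ℝ) < L := hL
  have main := hI.ofReal_one_sub_le μ hmeas hZ hind
  have hpulls : (n : ℝ) ≤ AdaptiveEval.B₀ I → ∀ ω r,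
      AdaptiveEval.B I r ≤ 2 * AdaptiveEval.B₀ I +
        2 * (64 * H ^ 2 * Real.log (6 / δ) / ε ^ 2) →
      (AdaptiveEval.totalPulls I (X ω) r : ℝ) ≤ 768 * (H ^ 2 * Real.log (6 / δ) / ε ^ 2 +
        (n : ℝ) ^ 2 * L * Real.log (12 * n / δ) / ε) := by
    intro hnB ω r hr
    have h1 := hI.totalPulls_le (X := X ω) hnB r
    have h2 : AdaptiveEval.B₀ I = 17 * ((n : ℝ) ^ 2 * L * Real.log (12 * n / δ) / ε) := by
      simp only [AdaptiveEval.B₀, I]; ring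
    have h3 : 0 ≤ (n : ℝ) ^ 2 * L * Real.log (12 * n / δ) / ε := by
      have : 0 < Real.log (12 * n / δ) := hI.log_pos
      positivity
    have h4 : 64 * H ^ 2 * Real.log (6 / δ) / ε ^ 2 =
      64 * (H ^ 2 * Real.log (6 / δ) / ε ^ 2) := by ring
    rw [h2, h4] at hr
    linarith
  have hnonneg : 0 ≤ H ^ 2 * Real.log (6 / δ) / ε ^ 2 +
      (n : ℝ) ^ 2 * L * Real.log (12 * n / δ) / ε := by
    have : 0 < Real.log (12 * n / δ) := hI.log_pos
    have : 0 < Real.log (6 / δ) := hI.log_six_pos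
    positivity
  refine ⟨main.trans (measure_mono ?_), fun hnB => main.trans (measure_mono ?_),
    fun hnB hδ2 => main.trans (measure_mono ?_)⟩
  · rintro ω ⟨r, hr, -, hacc⟩
    exact ⟨_, _, ⟨r, hr, rfl, rfl⟩, hacc⟩
  · rintro ω ⟨r, hr, hB, hacc⟩
    refine ⟨_, _, ⟨r, hr, rfl, rfl⟩, hacc, (hpulls hnB ω r hB).trans ?_⟩
    linarith
  · rintro ω ⟨r, hr, hB, hacc⟩
    refine ⟨_, _, ⟨r, hr, rfl, rfl⟩, hacc, (hpulls hnB ω r hB).trans ?_⟩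
    have h2 : 2 ≤ 1 / δ := by
      rw [le_div_iff₀ hδ]; linarith
    have hnδ : 1 / δ ≤ n / δ := by gcongr
    have h6 : Real.log (6 / δ) ≤ 5 * Real.log (1 / δ) := by
      have h := AdaptiveEval.log_mul_le_five_mul_log (c := 6) (by norm_num) (by norm_num) h2
      rwa [mul_one_div] at h
    have h12 : Real.log (12 * n / δ) ≤ 5 * Real.log (n / δ) := by
      have h := AdaptiveEval.log_mul_le_five_mul_log (c := 12) (by norm_num) (by norm_num)
        (h2.trans hnδ)
      rwa [← mul_div_assoc] at h
    calc 768 * (H ^ 2 * Real.log (6 / δ) / ε ^ 2 +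
          (n : ℝ) ^ 2 * L * Real.log (12 * n / δ) / ε)
        ≤ 768 * (H ^ 2 * (5 * Real.log (1 / δ)) / ε ^ 2 +
          (n : ℝ) ^ 2 * L * (5 * Real.log (n / δ)) / ε) := by gcongr
      _ = _ := by ring
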